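/- A polyomino is a nonempty finite set $P$ of unit cells $[x,x+1]\times[y,y+1]$ ($x,y\in\mathbb{Z}$) of the plane that is connected with respect to edge adjacency, considered up to translation. It is represented by the binary matrix whose dimensions are those of its minimal bounding rectangle and whose entries, displayed so that the top row of the matrix corresponds to the top row of cells, are $1$ at the cells of $P$ and $0$ elsewhere. A polyomino avoids a binary matrix $A$ if $A$ cannot be obtained from the matrix representing it by deleting rows and columns. The boundary of $P$ consists of the unit edges that separate a cell of $P$ from a cell not in $P$. A parallelogram polyomino is a polyomino whose boundary can be decomposed into two lattice paths (the upper and the lower path), made of north and east unit steps, with the same starting point and the same final point, which meet only at these two points. Proposition. The parallelogram polyominoes are exactly the polyominoes that avoid both $$\begin{bmatrix}1&0\\1&1\end{bmatrix}\quad\text{and}\quad\begin{bmatrix}1&1\\0&1\end{bmatrix}.$$ -/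

import Mathlib

/-- Two cells are adjacent when they share an edge. The cell `(x, y)` stands for the unit
square `[x, x+1] × [y, y+1]` of the plane. -/
def cellGraph : SimpleGraph (ℤ × ℤ) where
  Adj a b := (a.1 = b.1 ∧ |a.2 - b.2| = 1) ∨ (a.2 = b.2 ∧ |a.1 - b.1| = 1)
  symm := ⟨by
    rintro a b (⟨h, h'⟩ | ⟨h, h'⟩)
    · exact Or.inl ⟨h.symm, by rwa [abs_sub_comm]⟩
    · exact Or.inr ⟨h.symm, by rwa [abs_sub_comm]⟩⟩
  loopless := ⟨by
    rintro a (⟨_, h⟩ | ⟨_, h⟩) <;> simp at h⟩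

/-- A polyomino: a finite set of cells, connected with respect to edge adjacency
(`SimpleGraph.Connected` includes non-emptiness). A polyomino is given here by one of its
positions in the plane; everything below is invariant under translation. -/
structure Polyomino where
  cells : Finset (ℤ × ℤ)
  connected : (cellGraph.induce (cells : Set (ℤ × ℤ))).Connected

/-- A binary matrix of arbitrary (finite) dimensions. Row `0` is the top row, as in the usual
display of matrices. -/
structure BinMatrix where
  rows : ℕ
  cols : ℕ
  entry : Matrix (Fin rows) (Fin cols) (Fin 2)

/-- The submatrix order: `A` is obtained from `M` by deleting rows and columns. -/
def BinMatrix.IsSubmatrix (A M : BinMatrix) : Prop :=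
  ∃ (r : Fin A.rows ↪o Fin M.rows) (c : Fin A.cols ↪o Fin M.cols),
    A.entry = M.entry.submatrix r c

namespace Polyomino

theorem nonempty (P : Polyomino) : P.cells.Nonempty := by
  obtain ⟨c⟩ := P.connected.nonempty
  exact ⟨c.1, c.2⟩

/-- Abscissa of the leftmost cells. -/
def xMin (P : Polyomino) : ℤ := (P.cells.image Prod.fst).min' (P.nonempty.image _)

/-- Abscissa of the rightmost cells. -/
def xMax (P : Polyomino) : ℤ := (P.cells.image Prod.fst).max' (P.nonempty.image _)

/-- Ordinate of the lowest cells. -/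
def yMin (P : Polyomino) : ℤ := (P.cells.image Prod.snd).min' (P.nonempty.image _)

/-- Ordinate of the highest cells. -/
def yMax (P : Polyomino) : ℤ := (P.cells.image Prod.snd).max' (P.nonempty.image _)

/-- The binary matrix representing a polyomino: it has the dimensions of the minimal bounding
rectangle, and, displayed as usual, it looks like the polyomino drawn in the plane: columns are
read from left to right and rows from the top (largest ordinate) to the bottom. -/
def toBinMatrix (P : Polyomino) : BinMatrix where
  rows := (P.yMax - P.yMin + 1).toNat
  cols := (P.xMax - P.xMin + 1).toNat
  entry := Matrix.of fun i j =>
    if (P.xMin + ((j : ℕ) : ℤ), P.yMax - ((i : ℕ) : ℤ)) ∈ P.cells then 1 else 0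

/-- The polyominoes that contain no submatrix belonging to `S`. -/
def Av (S : Set BinMatrix) : Set Polyomino :=
  {P | ∀ A ∈ S, ¬ A.IsSubmatrix P.toBinMatrix}

end Polyomino

/-- North and east unit steps. -/
inductive LatticeStep where
  | north : LatticeStep
  | east : LatticeStep

/-- The lattice point reached from `p` by one step. -/
def LatticeStep.move : LatticeStep → ℤ × ℤ → ℤ × ℤ
  | .north, p => (p.1, p.2 + 1)
  | .east, p => (p.1 + 1, p.2)

/-- A unit edge of the lattice, encoded by its lower/left endpoint and its direction:
`(p, s)` is the segment from `p` to `s.move p`. -/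
abbrev LatticeEdge : Type := (ℤ × ℤ) × LatticeStep

/-- The two cells on either side of an edge. -/
def LatticeEdge.sides : LatticeEdge → (ℤ × ℤ) × (ℤ × ℤ)
  | (p, .north) => ((p.1 - 1, p.2), p)
  | (p, .east) => (p, (p.1, p.2 - 1))

/-- The last point of the path that starts at `p` and performs the given steps. -/
def pathEnd : ℤ × ℤ → List LatticeStep → ℤ × ℤ
  | p, [] => p
  | p, s :: w => pathEnd (s.move p) w

/-- All lattice points on the path that starts at `p` and performs the given steps. -/
def pathPoints : ℤ × ℤ → List LatticeStep → Set (ℤ × ℤ)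
  | p, [] => {p}
  | p, s :: w => insert p (pathPoints (s.move p) w)

/-- All unit edges of the path that starts at `p` and performs the given steps. -/
def pathEdges : ℤ × ℤ → List LatticeStep → Set LatticeEdge
  | _, [] => ∅
  | p, s :: w => insert (p, s) (pathEdges (s.move p) w)

namespace Polyomino

/-- The boundary of a polyomino: the unit edges that separate a cell of the polyomino from a
cell outside it. -/
def boundary (P : Polyomino) : Set LatticeEdge :=
  {e | Xor ((LatticeEdge.sides e).1 ∈ P.cells) ((LatticeEdge.sides e).2 ∈ P.cells)}

/-- Parallelogram polyominoes: the boundary decomposes into two paths `u` and `l` made of north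
and east unit steps, with common starting point `p` and common final point `q`, which meet only
at `p` and `q` (no other common lattice point, and no common edge). -/
def IsParallelogram (P : Polyomino) : Prop :=
  ∃ (p q : ℤ × ℤ) (u l : List LatticeStep),
    pathEnd p u = q ∧ pathEnd p l = q ∧
    pathPoints p u ∩ pathPoints p l = {p, q} ∧
    Disjoint (pathEdges p u) (pathEdges p l) ∧
    P.boundary = pathEdges p u ∪ pathEdges p l

end Polyomino

/-! ### Submatrices of order two -/

/-! Avoiding the two patterns means `FillsCorners`: a cell with another cell below it and another to
its right (at any distance) forces the fourth corner of the rectangle they define, and dually for a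
bottom right corner pattern; `Polyomino.mem_Av_iff_fillsCorners` makes this translation.

In a parallelogram polyomino, each column is the interval between the east steps of the two paths
over it. Both heights are nondecreasing from left to right, and corners are filled by comparing
intervals.

Conversely, the key fact is `Polyomino.linked`: two cells of a polyomino that fills corners are
joined by a monotone path inside it or are the top left and bottom right corners of a full
rectangle. It is proved by moving one cell at a time, symmetry reducing the four directions to
`Linked.south`. It implies that columns are intervals, that their ends are nondecreasing and that
consecutive columns overlap (`Polyomino.exists_profile`). The staircases through the lower and upper
ends are then the two boundary paths. -/

theorem Polyomino.isSubmatrix_two_iff (P : Polyomino) (M : Matrix (Fin 2) (Fin 2) (Fin 2))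
    (hM : ∃ a b, M 0 a = 1 ∧ M 1 b = 1) (hM' : ∃ a b, M a 0 = 1 ∧ M b 1 = 1) :
    (⟨2, 2, M⟩ : BinMatrix).IsSubmatrix P.toBinMatrix ↔
      ∃ x₁ x₂ y₁ y₂ : ℤ, x₁ < x₂ ∧ y₁ < y₂ ∧
        M 0 0 = (if (x₁, y₂) ∈ P.cells then 1 else 0) ∧
        M 0 1 = (if (x₂, y₂) ∈ P.cells then 1 else 0) ∧
        M 1 0 = (if (x₁, y₁) ∈ P.cells then 1 else 0) ∧
        M 1 1 = (if (x₂, y₁) ∈ P.cells then 1 else 0) := by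
  constructor
  · rintro ⟨r, c, h⟩
    have hr : r 0 < r 1 := r.strictMono Fin.zero_lt_one
    have hc : c 0 < c 1 := c.strictMono Fin.zero_lt_one
    have hr' : ((r 0 : ℕ) : ℤ) < ((r 1 : ℕ) : ℤ) := by exact_mod_cast hr
    have hc' : ((c 0 : ℕ) : ℤ) < ((c 1 : ℕ) : ℤ) := by exact_mod_cast hc
    refine ⟨P.xMin + ((c 0 : ℕ) : ℤ), P.xMin + ((c 1 : ℕ) : ℤ),
      P.yMax - ((r 1 : ℕ) : ℤ), P.yMax - ((r 0 : ℕ) : ℤ), by omega, by omega, ?_, ?_, ?_, ?_⟩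
    · exact congrFun (congrFun h 0) 0
    · exact congrFun (congrFun h 0) 1
    · exact congrFun (congrFun h 1) 0
    · exact congrFun (congrFun h 1) 1
  · rintro ⟨x₁, x₂, y₁, y₂, hx, hy, h00, h01, h10, h11⟩
    have bd : ∀ x y, (x, y) ∈ P.cells →
        P.xMin ≤ x ∧ x ≤ P.xMax ∧ P.yMin ≤ y ∧ y ≤ P.yMax := fun x y h =>
      ⟨Finset.min'_le _ _ (Finset.mem_image.2 ⟨_, h, rfl⟩),
        Finset.le_max' (P.cells.image Prod.fst) _ (Finset.mem_image.2 ⟨_, h, rfl⟩),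
        Finset.min'_le _ _ (Finset.mem_image.2 ⟨_, h, rfl⟩),
        Finset.le_max' (P.cells.image Prod.snd) _ (Finset.mem_image.2 ⟨_, h, rfl⟩)⟩
    have mem : ∀ (x y : ℤ), (1 : Fin 2) = (if (x, y) ∈ P.cells then 1 else 0) →
        (x, y) ∈ P.cells := by
      intro x y h
      by_contra h'
      simp [h'] at h
    -- A zero of `M` could be read outside the bounding rectangle; a one in every row and column of
    -- `M` rules this out.
    have key : (P.yMin ≤ y₁ ∧ y₂ ≤ P.yMax) ∧ (P.xMin ≤ x₁ ∧ x₂ ≤ P.xMax) := by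
      obtain ⟨a, b, ha, hb⟩ := hM
      obtain ⟨c, d, hc, hd⟩ := hM'
      constructor
      · have h2 : y₂ ≤ P.yMax := by
          fin_cases a
          · exact (bd _ _ (mem x₁ y₂ (ha.symm.trans h00))).2.2.2
          · exact (bd _ _ (mem x₂ y₂ (ha.symm.trans h01))).2.2.2
        have h1 : P.yMin ≤ y₁ := by
          fin_cases b
          · exact (bd _ _ (mem x₁ y₁ (hb.symm.trans h10))).2.2.1
          · exact (bd _ _ (mem x₂ y₁ (hb.symm.trans h11))).2.2.1
        exact ⟨h1, h2⟩
      · have h1 : P.xMin ≤ x₁ := by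
          fin_cases c
          · exact (bd _ _ (mem x₁ y₂ (hc.symm.trans h00))).1
          · exact (bd _ _ (mem x₁ y₁ (hc.symm.trans h10))).1
        have h2 : x₂ ≤ P.xMax := by
          fin_cases d
          · exact (bd _ _ (mem x₂ y₂ (hd.symm.trans h01))).2.1
          · exact (bd _ _ (mem x₂ y₁ (hd.symm.trans h11))).2.1
        exact ⟨h1, h2⟩
    obtain ⟨⟨hy1, hy2⟩, hx1, hx2⟩ := key
    have emb : ∀ (n : ℕ) (i j : ℤ), 0 ≤ i → i < j → j < n →
        ∃ f : Fin 2 ↪o Fin n, ((f 0 : ℕ) : ℤ) = i ∧ ((f 1 : ℕ) : ℤ) = j := by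
      intro n i j hi hij hj
      refine ⟨OrderEmbedding.ofStrictMono
        ![⟨i.toNat, by omega⟩, ⟨j.toNat, by omega⟩] ?_, ?_, ?_⟩
      · intro a b hab
        fin_cases a <;> fin_cases b <;> (simp at hab ⊢; try omega)
      · exact Int.toNat_of_nonneg hi
      · exact Int.toNat_of_nonneg (hi.trans hij.le)
    obtain ⟨r, hr0, hr1⟩ := emb (P.yMax - P.yMin + 1).toNat (P.yMax - y₂) (P.yMax - y₁)
      (by omega) (by omega) (by omega)
    obtain ⟨c, hc0, hc1⟩ := emb (P.xMax - P.xMin + 1).toNat (x₁ - P.xMin) (x₂ - P.xMin)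
      (by omega) (by omega) (by omega)
    refine ⟨r, c, ?_⟩
    have e1 : P.xMin + (x₁ - P.xMin) = x₁ := by ring
    have e2 : P.xMin + (x₂ - P.xMin) = x₂ := by ring
    have e3 : P.yMax - (P.yMax - y₂) = y₂ := by ring
    have e4 : P.yMax - (P.yMax - y₁) = y₁ := by ring
    have ent : ∀ i j : Fin 2, M i j =
        if (P.xMin + ((c j : ℕ) : ℤ), P.yMax - ((r i : ℕ) : ℤ)) ∈ P.cells then 1 else 0 := by
      intro i j
      fin_cases i <;> fin_cases j
      · simpa only [Fin.zero_eta, Fin.mk_one, hr0, hc0, e1, e3] using h00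
      · simpa only [Fin.zero_eta, Fin.mk_one, hr0, hc1, e2, e3] using h01
      · simpa only [Fin.zero_eta, Fin.mk_one, hr1, hc0, e1, e4] using h10
      · simpa only [Fin.zero_eta, Fin.mk_one, hr1, hc1, e2, e4] using h11
    ext i j
    exact congrArg _ (ent i j)

/-- Whenever `S` contains three corners of a rectangle, one of them being the top left one and
one the bottom right one, it contains the fourth. -/
structure FillsCorners (S : Set (ℤ × ℤ)) : Prop where
  topRight : ∀ {x₁ x₂ y₁ y₂ : ℤ}, x₁ < x₂ → y₁ < y₂ →
    (x₁, y₁) ∈ S → (x₁, y₂) ∈ S → (x₂, y₁) ∈ S → (x₂, y₂) ∈ S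
  bottomLeft : ∀ {x₁ x₂ y₁ y₂ : ℤ}, x₁ < x₂ → y₁ < y₂ →
    (x₂, y₂) ∈ S → (x₁, y₂) ∈ S → (x₂, y₁) ∈ S → (x₁, y₁) ∈ S

theorem Polyomino.mem_Av_iff_fillsCorners (P : Polyomino) :
    P ∈ Polyomino.Av {⟨2, 2, !![1, 0; 1, 1]⟩, ⟨2, 2, !![1, 1; 0, 1]⟩} ↔
      FillsCorners (P.cells : Set (ℤ × ℤ)) := by
  have one_eq : ∀ p : Prop, [Decidable p] → ((1 : Fin 2) = (if p then 1 else 0) ↔ p) := by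
    intro p _
    by_cases h : p <;> simp [h]
  have zero_eq : ∀ p : Prop, [Decidable p] → ((0 : Fin 2) = (if p then 1 else 0) ↔ ¬ p) := by
    intro p _
    by_cases h : p <;> simp [h]
  have h1 := P.isSubmatrix_two_iff !![1, 0; 1, 1] ⟨0, 0, rfl, rfl⟩ ⟨0, 1, rfl, rfl⟩
  have h2 := P.isSubmatrix_two_iff !![1, 1; 0, 1] ⟨0, 1, rfl, rfl⟩ ⟨0, 1, rfl, rfl⟩
  simp only [Matrix.of_apply, Matrix.cons_val', Matrix.cons_val_zero, Matrix.cons_val_one,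
    Matrix.cons_val_fin_one, one_eq, zero_eq] at h1 h2
  simp only [Polyomino.Av, Set.mem_ofPred_eq, Set.mem_insert_iff, Set.mem_singleton_iff,
    forall_eq_or_imp, forall_eq, h1, h2]
  constructor
  · rintro ⟨ha, hb⟩
    refine ⟨fun {x₁ x₂ y₁ y₂} hx hy p q r => ?_, fun {x₁ x₂ y₁ y₂} hx hy p q r => ?_⟩
    · by_contra hn
      exact ha ⟨x₁, x₂, y₁, y₂, hx, hy, q, hn, p, r⟩
    · by_contra hn
      exact hb ⟨x₁, x₂, y₁, y₂, hx, hy, q, p, hn, r⟩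
  · rintro h
    constructor
    · rintro ⟨x₁, x₂, y₁, y₂, hx, hy, p, q, r, s⟩
      exact q (h.topRight hx hy r p s)
    · rintro ⟨x₁, x₂, y₁, y₂, hx, hy, p, q, r, s⟩
      exact r (h.bottomLeft hx hy q p s)

/-! ### Parallelogram polyominoes fill corners -/

theorem pathEdges_east_bounds {p : ℤ × ℤ} {w : List LatticeStep} {x y : ℤ}
    (h : ((x, y), LatticeStep.east) ∈ pathEdges p w) :
    p.1 ≤ x ∧ x < (pathEnd p w).1 ∧ p.2 ≤ y := by
  have le_end : ∀ (w : List LatticeStep) (p : ℤ × ℤ), p.1 ≤ (pathEnd p w).1 := by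
    intro w
    induction w with
    | nil => intro p; exact le_rfl
    | cons s w ih =>
      intro p
      have := ih (s.move p)
      cases s <;> simp only [LatticeStep.move, pathEnd] at this ⊢ <;> omega
  induction w generalizing p with
  | nil => exact h.elim
  | cons s w ih =>
    rcases h with h | h
    · obtain ⟨rfl, rfl⟩ := Prod.mk.inj h
      have := le_end w (LatticeStep.east.move (x, y))
      simp only [LatticeStep.move, pathEnd] at this ⊢
      omega
    · have := ih h
      cases s <;> simp only [LatticeStep.move, pathEnd] at this ⊢ <;> omega

theorem pathEdges_east_exists {p : ℤ × ℤ} {w : List LatticeStep} {x : ℤ}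
    (h₁ : p.1 ≤ x) (h₂ : x < (pathEnd p w).1) :
    ∃ y, ((x, y), LatticeStep.east) ∈ pathEdges p w := by
  induction w generalizing p with
  | nil => simp only [pathEnd] at h₂; omega
  | cons s w ih =>
    cases s with
    | north =>
      obtain ⟨y, hy⟩ := ih (p := LatticeStep.north.move p) h₁ h₂
      exact ⟨y, Or.inr hy⟩
    | east =>
      by_cases hx : p.1 = x
      · exact ⟨p.2, Or.inl (by rw [← hx])⟩
      · obtain ⟨y, hy⟩ := ih (p := LatticeStep.east.move p)
          (by simp only [LatticeStep.move]; omega) h₂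
        exact ⟨y, Or.inr hy⟩

theorem pathEdges_east_mono {p : ℤ × ℤ} {w : List LatticeStep} {x x' y y' : ℤ}
    (h : ((x, y), LatticeStep.east) ∈ pathEdges p w)
    (h' : ((x', y'), LatticeStep.east) ∈ pathEdges p w) (hx : x ≤ x') : y ≤ y' := by
  induction w generalizing p with
  | nil => exact h.elim
  | cons s w ih =>
    rcases h with h | h <;> rcases h' with h' | h'
    · obtain ⟨rfl, rfl⟩ := Prod.mk.inj h
      simp only [Prod.mk.injEq] at h'
      omega
    · obtain ⟨rfl, rfl⟩ := Prod.mk.inj h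
      have := pathEdges_east_bounds h'
      simp only [LatticeStep.move] at this
      omega
    · obtain ⟨rfl, rfl⟩ := Prod.mk.inj h'
      have := pathEdges_east_bounds h
      simp only [LatticeStep.move] at this
      omega
    · exact ih h h'

/-- A finite set of integers whose indicator changes only at `a` and at `b`. -/
theorem Finset.eq_Ico_of_xor_iff {s : Finset ℤ} {a b : ℤ} (hab : a ≤ b)
    (h : ∀ y, Xor (y ∈ s) (y - 1 ∈ s) ↔ Xor (y = a) (y = b)) (y : ℤ) :
    y ∈ s ↔ a ≤ y ∧ y < b := by
  obtain ⟨N, hN⟩ := s.bddBelow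
  have hN' : ∀ z, z < N → z ∉ s := fun z hz hs => absurd (hN hs) (by simpa using hz)
  rcases lt_or_ge y (min N a) with hy | hy
  · have := hN' y (by omega)
    constructor
    · intro h'; exact absurd h' this
    · omega
  -- The induction starts below both `s` and `a`, where both sides are false.
  · have hstart : min N a - 1 ∉ s := hN' _ (by omega)
    suffices ∀ z, min N a - 1 ≤ z → (z ∈ s ↔ a ≤ z ∧ z < b) from this y (by omega)
    intro z hz
    induction z, hz using Int.leInduction with
    | base =>
      constructor
      · intro h'; exact absurd h' hstart
      · omega
    | succ z hz ih =>
      have h1 := h (z + 1)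
      rw [add_sub_cancel_right, ih] at h1
      simp only [Xor] at h1
      by_cases hs : z + 1 ∈ s <;> simp only [hs, true_iff, false_iff, true_and, false_and,
        not_true_eq_false, not_false_eq_true, and_true, and_false, or_false, false_or] at h1 ⊢ <;>
        omega

/-- East edges of the boundary mark the changes of membership along a column, and each path has
exactly one over each column it crosses. Which path is the upper one need not be known: the minimum
and the maximum of two nondecreasing heights are nondecreasing. -/
theorem Polyomino.IsParallelogram.fillsCorners {P : Polyomino} (hP : P.IsParallelogram) :
    FillsCorners (P.cells : Set (ℤ × ℤ)) := by
  obtain ⟨p, q, u, l, hu, hl, -, hd, hb⟩ := hP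
  have hmem : ∀ x y : ℤ, Xor ((x, y) ∈ P.cells) ((x, y - 1) ∈ P.cells) ↔
      ((x, y), LatticeStep.east) ∈ pathEdges p u ∨
        ((x, y), LatticeStep.east) ∈ pathEdges p l := by
    intro x y
    have : ((x, y), LatticeStep.east) ∈ P.boundary ↔
      ((x, y), LatticeStep.east) ∈ pathEdges p u ∪ pathEdges p l := by rw [hb]
    exact this
  have col : ∀ x y : ℤ, (x, y) ∈ P.cells → ∃ a b : ℤ,
      ((x, a), LatticeStep.east) ∈ pathEdges p u ∧
      ((x, b), LatticeStep.east) ∈ pathEdges p l ∧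
      ∀ z, (x, z) ∈ P.cells ↔ min a b ≤ z ∧ z < max a b := by
    intro x y hxy
    classical
    let s : Finset ℤ := (P.cells.filter fun c => c.1 = x).image Prod.snd
    have hs : ∀ z, z ∈ s ↔ (x, z) ∈ P.cells := by
      intro z
      simp only [s, Finset.mem_image, Finset.mem_filter]
      constructor
      · rintro ⟨⟨c, d⟩, ⟨h, rfl⟩, rfl⟩
        exact h
      · intro h
        exact ⟨(x, z), ⟨h, rfl⟩, rfl⟩
    -- The edge above the highest cell of the column lies on one of the paths, so both paths cross
    -- this column.
    have hx : p.1 ≤ x ∧ x < q.1 := by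
      obtain ⟨m, hm, hmax⟩ := s.exists_max_image id ⟨y, (hs y).2 hxy⟩
      have hm1 : (x, m + 1) ∉ P.cells := by
        intro h
        have := hmax _ ((hs _).2 h)
        simp only [id] at this
        omega
      have hX : Xor ((x, m + 1) ∈ P.cells) ((x, m + 1 - 1) ∈ P.cells) := by
        rw [add_sub_cancel_right]
        exact Or.inr ⟨(hs m).1 hm, hm1⟩
      rcases (hmem _ _).1 hX with h | h
      · have := pathEdges_east_bounds h
        rw [hu] at this
        exact ⟨this.1, this.2.1⟩
      · have := pathEdges_east_bounds h
        rw [hl] at this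
        exact ⟨this.1, this.2.1⟩
    obtain ⟨a, ha⟩ := pathEdges_east_exists (w := u) hx.1 (hu ▸ hx.2)
    obtain ⟨b, hb'⟩ := pathEdges_east_exists (w := l) hx.1 (hl ▸ hx.2)
    -- Equal heights would give a common edge; distinct ones turn the union of the paths into an
    -- exclusive or.
    have hab : a ≠ b := by
      rintro rfl
      exact Set.disjoint_left.1 hd ha hb'
    refine ⟨a, b, ha, hb', fun z => ?_⟩
    rw [← hs]
    refine Finset.eq_Ico_of_xor_iff min_le_max (fun y => ?_) z
    rw [hs, hs, hmem]
    have e1 : ((x, y), LatticeStep.east) ∈ pathEdges p u ↔ y = a := by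
      constructor
      · intro h
        exact le_antisymm (pathEdges_east_mono h ha le_rfl) (pathEdges_east_mono ha h le_rfl)
      · rintro rfl; exact ha
    have e2 : ((x, y), LatticeStep.east) ∈ pathEdges p l ↔ y = b := by
      constructor
      · intro h
        exact le_antisymm (pathEdges_east_mono h hb' le_rfl) (pathEdges_east_mono hb' h le_rfl)
      · rintro rfl; exact hb'
    rw [e1, e2]
    simp only [Xor]
    omega
  refine ⟨fun {x₁ x₂ y₁ y₂} hx hy h1 h2 h3 => ?_, fun {x₁ x₂ y₁ y₂} hx hy h1 h2 h3 => ?_⟩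
  · obtain ⟨a, b, ha, hb1, hc⟩ := col _ _ h2
    obtain ⟨a', b', ha', hb1', hc'⟩ := col _ _ h3
    have hA := pathEdges_east_mono ha ha' hx.le
    have hB := pathEdges_east_mono hb1 hb1' hx.le
    have := (hc y₂).1 h2
    have := (hc' y₁).1 h3
    exact (hc' y₂).2 (by omega)
  · obtain ⟨a, b, ha, hb1, hc⟩ := col _ _ h2
    obtain ⟨a', b', ha', hb1', hc'⟩ := col _ _ h3
    have hA := pathEdges_east_mono ha ha' hx.le
    have hB := pathEdges_east_mono hb1 hb1' hx.le
    have := (hc y₂).1 h2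
    have := (hc' y₁).1 h3
    exact (hc y₁).2 (by omega)

/-! ### Sets that fill corners: linked cells -/

/-- A north or east step between two cells of `S`. -/
def NorthEastStep (S : Set (ℤ × ℤ)) (a b : ℤ × ℤ) : Prop :=
  a ∈ S ∧ b ∈ S ∧ (b = (a.1 + 1, a.2) ∨ b = (a.1, a.2 + 1))

/-- `b` can be reached from `a` inside `S` by north and east steps. -/
def NorthEastReach (S : Set (ℤ × ℤ)) : ℤ × ℤ → ℤ × ℤ → Prop :=
  Relation.ReflTransGen (NorthEastStep S)

/-- `a` and `b` are the top left and bottom right corners of a rectangle contained in `S`. -/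
def SpansRectangle (S : Set (ℤ × ℤ)) (a b : ℤ × ℤ) : Prop :=
  a.1 ≤ b.1 ∧ b.2 ≤ a.2 ∧ ∀ x y, a.1 ≤ x → x ≤ b.1 → b.2 ≤ y → y ≤ a.2 → (x, y) ∈ S

/-- Two cells joined in `S` by a monotone path or spanning a rectangle in `S`. -/
def Linked (S : Set (ℤ × ℤ)) (a b : ℤ × ℤ) : Prop :=
  NorthEastReach S a b ∨ NorthEastReach S b a ∨ SpansRectangle S a b ∨ SpansRectangle S b a

theorem NorthEastReach.le {S : Set (ℤ × ℤ)} {a b : ℤ × ℤ} (h : NorthEastReach S a b) :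
    a.1 ≤ b.1 ∧ a.2 ≤ b.2 := by
  induction h with
  | refl => exact ⟨le_rfl, le_rfl⟩
  | tail _ h ih => obtain ⟨-, -, rfl | rfl⟩ := h <;> constructor <;> dsimp only <;> omega

theorem NorthEastReach.exists_row {S : Set (ℤ × ℤ)} {a b : ℤ × ℤ} (h : NorthEastReach S a b)
    (ha : a ∈ S) {y : ℤ} (h₁ : a.2 ≤ y) (h₂ : y ≤ b.2) :
    ∃ x, a.1 ≤ x ∧ x ≤ b.1 ∧ (x, y) ∈ S := by
  induction h with
  | refl =>
    obtain rfl : a.2 = y := le_antisymm h₁ h₂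
    exact ⟨a.1, le_rfl, le_rfl, ha⟩
  | @tail b c hab h ih =>
    have := NorthEastReach.le hab
    obtain ⟨-, hc, rfl | rfl⟩ := h <;> dsimp only at h₂ ⊢
    · obtain ⟨x, hx, hx', hS⟩ := ih h₂
      exact ⟨x, hx, by omega, hS⟩
    · by_cases hy : y = b.2 + 1
      · exact ⟨b.1, this.1, le_rfl, hy ▸ hc⟩
      · exact ih (by omega)

theorem NorthEastReach.exists_east {S : Set (ℤ × ℤ)} {a b : ℤ × ℤ} (h : NorthEastReach S a b)
    {x : ℤ} (h₁ : a.1 ≤ x) (h₂ : x < b.1) : ∃ y, (x, y) ∈ S ∧ (x + 1, y) ∈ S := by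
  induction h with
  | refl => omega
  | @tail b c hab h ih =>
    obtain ⟨hb, hc, rfl | rfl⟩ := h <;> dsimp only at h₂
    · by_cases hx : x = b.1
      · subst hx
        exact ⟨b.2, hb, hc⟩
      · exact ih (by omega)
    · exact ih h₂

theorem northEastReach_row {S : Set (ℤ × ℤ)} {x y : ℤ} (n : ℕ)
    (h : ∀ i : ℤ, 0 ≤ i → i ≤ n → (x + i, y) ∈ S) : NorthEastReach S (x, y) (x + n, y) := by
  induction n with
  | zero =>
    rw [Nat.cast_zero, add_zero]
    exact Relation.ReflTransGen.refl
  | succ n ih =>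
    refine (ih fun i hi hi' => h i hi (by push_cast; omega)).tail
      ⟨h n (by omega) (by push_cast; omega), h _ (by omega) le_rfl, Or.inl ?_⟩
    push_cast
    simp only [add_assoc]

/-- Below a path from `a` to `b`, a final north step is simply undone, while a final east step is
pushed down by `bottomLeft`. A path from `b` to `a` is prolonged backwards. A rectangle ending at
`b` gains a row, and one starting at `b` loses its top row. -/
theorem Linked.south {S : Set (ℤ × ℤ)} (hS : FillsCorners S) {a b c : ℤ × ℤ}
    (h : Linked S a b) (hb : b ∈ S) (hc : c ∈ S) (hbc : c = (b.1, b.2 - 1)) :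
    Linked S a c := by
  have hcb : NorthEastStep S c b := ⟨hc, hb, Or.inr (by subst hbc; simp)⟩
  rcases h with h | h | h | h
  -- Only these two outcomes occur, and keeping just them lets the induction close: each can be
  -- extended by one east step.
  · suffices NorthEastReach S a c ∨ SpansRectangle S a c from
      this.elim Or.inl fun h => Or.inr (Or.inr (Or.inl h))
    clear hcb
    induction h generalizing c with
    | refl =>
      right
      subst hbc
      refine ⟨le_rfl, by dsimp only; omega, fun x y h1 h2 h3 h4 => ?_⟩
      dsimp only at h1 h2 h3 h4
      obtain rfl : x = a.1 := by omega
      by_cases hy : y = a.2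
      · exact hy ▸ hb
      · obtain rfl : y = a.2 - 1 := by omega
        exact hc
    | @tail b' b hab hstep ih =>
      obtain ⟨hb', -, rfl | rfl⟩ := hstep
      · dsimp only at hbc
        subst hbc
        have hc' : (b'.1, b'.2 - 1) ∈ S :=
          hS.bottomLeft (x₂ := b'.1 + 1) (y₂ := b'.2) (by omega) (by omega) hb hb' hc
        have hle := NorthEastReach.le hab
        rcases ih hb' hc' rfl with h | ⟨h1, h2, h3⟩
        · exact Or.inl (h.tail ⟨hc', hc, Or.inl rfl⟩)
        · right
          dsimp only at h1 h2 h3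
          refine ⟨by dsimp only; omega, h2, fun x y k1 k2 k3 k4 => ?_⟩
          dsimp only at k1 k2 k3 k4
          by_cases hx : x = b'.1 + 1
          · subst hx
            by_cases hy : y = b'.2
            · exact hy ▸ hb
            · obtain rfl : y = b'.2 - 1 := by omega
              exact hc
          · exact h3 x y k1 (by omega) k3 k4
      · left
        have : c = b' := by
          subst hbc
          simp
        exact this ▸ hab
  · exact Or.inr (Or.inl (Relation.ReflTransGen.head hcb h))
  · obtain ⟨h1, h2, h3⟩ := h
    subst hbc
    refine Or.inr (Or.inr (Or.inl ⟨h1, by dsimp only; omega, fun x y k1 k2 k3 k4 => ?_⟩))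
    dsimp only at k1 k2 k3 k4
    by_cases hy : b.2 ≤ y
    · exact h3 x y k1 k2 hy k4
    · obtain rfl : y = b.2 - 1 := by omega
      rcases k2.lt_or_eq with hx | rfl
      · exact hS.bottomLeft (x₂ := b.1) (y₂ := b.2) hx (by omega) hb
          (h3 x b.2 k1 k2 le_rfl h2) hc
      · exact hc
  · obtain ⟨h1, h2, h3⟩ := h
    rcases h2.lt_or_eq with hy | hy
    · subst hbc
      refine Or.inr (Or.inr (Or.inr ⟨h1, by dsimp only; omega, fun x y k1 k2 k3 k4 => ?_⟩))
      dsimp only at k1 k2 k3 k4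
      exact h3 x y k1 k2 k3 (by omega)
    -- A rectangle with a single row has no row left to lose; it is an east path from `b` to `a`,
    -- preceded by the step from `c`.
    · have := northEastReach_row (S := S) (x := b.1) (y := b.2) (a.1 - b.1).toNat
        fun i hi hi' => h3 _ _ (by omega) (by omega) (by omega) le_rfl
      have e : (b.1 + ((a.1 - b.1).toNat : ℤ), b.2) = a := Prod.ext (by dsimp only; omega) hy.symm
      rw [e] at this
      exact Or.inr (Or.inl (Relation.ReflTransGen.head hcb this))

/-- Reflection in the diagonal exchanges the top left and bottom right corners and fixes the other
two; the point reflection below exchanges the two filled corners. -/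
theorem FillsCorners.preimage_swap {S : Set (ℤ × ℤ)} (hS : FillsCorners S) :
    FillsCorners (Prod.swap ⁻¹' S) :=
  ⟨fun hx hy h1 h2 h3 => hS.topRight hy hx h1 h3 h2,
    fun hx hy h1 h2 h3 => hS.bottomLeft hy hx h1 h3 h2⟩

theorem FillsCorners.preimage_neg {S : Set (ℤ × ℤ)} (hS : FillsCorners S) :
    FillsCorners (Neg.neg ⁻¹' S) :=
  ⟨fun hx hy h1 h2 h3 => hS.bottomLeft (neg_lt_neg hx) (neg_lt_neg hy) h1 h3 h2,
    fun hx hy h1 h2 h3 => hS.topRight (neg_lt_neg hx) (neg_lt_neg hy) h1 h3 h2⟩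

theorem Linked.swap {S : Set (ℤ × ℤ)} {a b : ℤ × ℤ} (h : Linked (Prod.swap ⁻¹' S) a b) :
    Linked S a.swap b.swap := by
  have key : ∀ {a b : ℤ × ℤ}, NorthEastReach (Prod.swap ⁻¹' S) a b →
      NorthEastReach S a.swap b.swap := by
    intro a b h
    induction h with
    | refl => exact Relation.ReflTransGen.refl
    | tail _ huv ih =>
      refine Relation.ReflTransGen.tail ih ?_
      obtain ⟨hu, hv, rfl | rfl⟩ := huv
      · exact ⟨hu, hv, Or.inr rfl⟩
      · exact ⟨hu, hv, Or.inl rfl⟩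
  have key' : ∀ {a b : ℤ × ℤ}, SpansRectangle (Prod.swap ⁻¹' S) a b →
      SpansRectangle S b.swap a.swap := fun {a b} ⟨h1, h2, h3⟩ =>
    ⟨h2, h1, fun x y k1 k2 k3 k4 => h3 y x k3 k4 k1 k2⟩
  rcases h with h | h | h | h
  · exact Or.inl (key h)
  · exact Or.inr (Or.inl (key h))
  · exact Or.inr (Or.inr (Or.inr (key' h)))
  · exact Or.inr (Or.inr (Or.inl (key' h)))

theorem Linked.neg {S : Set (ℤ × ℤ)} {a b : ℤ × ℤ} (h : Linked (Neg.neg ⁻¹' S) a b) :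
    Linked S (-a) (-b) := by
  have key : ∀ {a b : ℤ × ℤ}, NorthEastReach (Neg.neg ⁻¹' S) a b →
      NorthEastReach S (-b) (-a) := by
    intro a b h
    induction h with
    | refl => exact Relation.ReflTransGen.refl
    | tail _ huv ih =>
      refine Relation.ReflTransGen.head ?_ ih
      obtain ⟨hu, hv, rfl | rfl⟩ := huv
      · exact ⟨hv, hu, Or.inl (by ext <;> simp)⟩
      · exact ⟨hv, hu, Or.inr (by ext <;> simp)⟩
  have key' : ∀ {a b : ℤ × ℤ}, SpansRectangle (Neg.neg ⁻¹' S) a b →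
      SpansRectangle S (-b) (-a) := fun {a b} ⟨h1, h2, h3⟩ =>
    ⟨neg_le_neg h1, neg_le_neg h2, fun x y k1 k2 k3 k4 => by
      simp only [Prod.fst_neg, Prod.snd_neg] at k1 k2 k3 k4
      simpa using h3 (-x) (-y) (by omega) (by omega) (by omega) (by omega)⟩
  rcases h with h | h | h | h
  · exact Or.inr (Or.inl (key h))
  · exact Or.inl (key h)
  · exact Or.inr (Or.inr (Or.inr (key' h)))
  · exact Or.inr (Or.inr (Or.inl (key' h)))

theorem Linked.north {S : Set (ℤ × ℤ)} (hS : FillsCorners S) {a b c : ℤ × ℤ}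
    (h : Linked S a b) (hb : b ∈ S) (hc : c ∈ S) (hbc : c = (b.1, b.2 + 1)) :
    Linked S a c := by
  have e : (Neg.neg ⁻¹' (Neg.neg ⁻¹' S) : Set (ℤ × ℤ)) = S := by ext; simp
  -- Writing `S` as a double preimage lets `Linked.neg` carry the hypothesis to the reflected set.
  rw [← e] at h
  have := (h.neg.south hS.preimage_neg (c := -c) (by simpa using hb) (by simpa using hc)
    (by subst hbc; ext <;> simp; omega)).neg
  simpa using this

theorem Linked.adj {S : Set (ℤ × ℤ)} (hS : FillsCorners S) {a b c : ℤ × ℤ}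
    (h : Linked S a b) (hb : b ∈ S) (hc : c ∈ S) (hbc : cellGraph.Adj b c) :
    Linked S a c := by
  rcases hbc with ⟨h1, h2⟩ | ⟨h1, h2⟩
  · rcases (abs_eq zero_le_one).1 h2 with h2 | h2
    · exact h.south hS hb hc (Prod.ext h1.symm (by dsimp only; omega))
    · exact h.north hS hb hc (Prod.ext h1.symm (by dsimp only; omega))
  · have h' : Linked (Prod.swap ⁻¹' S) a.swap b.swap := Linked.swap h
    rcases (abs_eq zero_le_one).1 h2 with h2 | h2
    · exact (h'.south hS.preimage_swap (c := c.swap) hb hc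
        (Prod.ext h1.symm (by dsimp only [Prod.swap]; omega))).swap
    · exact (h'.north hS.preimage_swap (c := c.swap) hb hc
        (Prod.ext h1.symm (by dsimp only [Prod.swap]; omega))).swap

theorem Polyomino.linked (P : Polyomino) (hP : FillsCorners (P.cells : Set (ℤ × ℤ)))
    {a b : ℤ × ℤ} (ha : a ∈ P.cells) (hb : b ∈ P.cells) :
    Linked (P.cells : Set (ℤ × ℤ)) a b := by
  have h := (SimpleGraph.reachable_iff_reflTransGen _ _).1
    (P.connected.preconnected ⟨a, ha⟩ ⟨b, hb⟩)
  suffices ∀ c : (P.cells : Set (ℤ × ℤ)),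
      Relation.ReflTransGen (cellGraph.induce (P.cells : Set (ℤ × ℤ))).Adj ⟨a, ha⟩ c →
        Linked (P.cells : Set (ℤ × ℤ)) a c from this _ h
  intro c hc
  induction hc with
  | refl => exact Or.inl Relation.ReflTransGen.refl
  | @tail c d _ hcd ih => exact ih.adj hP c.2 d.2 hcd

/-! ### Column profile of a polyomino that fills corners -/

/-- The columns of a polyomino that fills corners are intervals `[f x, g x)`, with `f` and `g`
nondecreasing and consecutive intervals meeting. Outside the range of columns, `f` and `g` take
the ordinate of the bottom left (resp. top right) corner. -/
theorem Polyomino.exists_profile (P : Polyomino) (hP : FillsCorners (P.cells : Set (ℤ × ℤ))) :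
    ∃ (x₀ : ℤ) (n : ℕ) (f g : ℤ → ℤ),
      Monotone f ∧ Monotone g ∧ f (x₀ - 1) = f x₀ ∧ g (x₀ - 1) = f x₀ ∧
      f (x₀ + n + 1) = g (x₀ + n + 1) ∧ g (x₀ + n) = g (x₀ + n + 1) ∧
      (∀ x, x₀ ≤ x → x ≤ x₀ + n → f x < g x) ∧
      (∀ x, x₀ ≤ x → x < x₀ + n → f (x + 1) < g x) ∧
      ∀ x y, (x, y) ∈ P.cells ↔ x₀ ≤ x ∧ x ≤ x₀ + n ∧ f x ≤ y ∧ y < g x := by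
  obtain ⟨p₀, hp₀, hmin⟩ := P.cells.exists_min_image Prod.fst P.nonempty
  obtain ⟨p₁, hp₁, hmax⟩ := P.cells.exists_max_image Prod.fst P.nonempty
  have h01 : p₀.1 ≤ p₁.1 := hmin _ hp₁
  have overlap : ∀ x, p₀.1 ≤ x → x < p₁.1 →
      ∃ y, (x, y) ∈ P.cells ∧ (x + 1, y) ∈ P.cells := by
    intro x h1 h2
    rcases P.linked hP hp₀ hp₁ with h | h | h | h
    · exact h.exists_east h1 h2
    · have := h.le
      omega
    -- The bottom row of the rectangle crosses all the columns.
    · exact ⟨p₁.2, h.2.2 _ _ h1 h2.le le_rfl h.2.1, h.2.2 _ _ (by omega) (by omega) le_rfl h.2.1⟩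
    · have := h.1
      omega
  have antidiag : ∀ {x x' y y' : ℤ}, x < x' → y' < y → (x, y) ∈ P.cells → (x', y') ∈ P.cells →
      (x', y) ∈ P.cells ∧ (x, y') ∈ P.cells := by
    intro x x' y y' hx hy h1 h2
    rcases P.linked hP h1 h2 with h | h | h | h
    · have := h.le
      dsimp only at this
      omega
    · have := h.le
      dsimp only at this
      omega
    · exact ⟨h.2.2 _ _ hx.le le_rfl hy.le le_rfl, h.2.2 _ _ le_rfl hx.le le_rfl hy.le⟩
    · have := h.1
      dsimp only at this
      omega
  have convex : ∀ {x y₁ y₂ y : ℤ}, (x, y₁) ∈ P.cells → (x, y₂) ∈ P.cells → y₁ ≤ y → y ≤ y₂ →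
      (x, y) ∈ P.cells := by
    intro x y₁ y₂ y h1 h2 hy1 hy2
    rcases P.linked hP h1 h2 with h | h | h | h
    · obtain ⟨x', k1, k2, k3⟩ := h.exists_row h1 hy1 hy2
      obtain rfl : x' = x := le_antisymm k2 k1
      exact k3
    · have := h.le.2
      dsimp only at this
      obtain rfl : y = y₁ := by omega
      exact h1
    · have := h.2.1
      dsimp only at this
      obtain rfl : y = y₁ := by omega
      exact h1
    · exact h.2.2 _ _ le_rfl le_rfl hy1 hy2
  have col : ∀ x, ∃ a b : ℤ, p₀.1 ≤ x → x ≤ p₁.1 →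
      a < b ∧ ∀ y, (x, y) ∈ P.cells ↔ a ≤ y ∧ y < b := by
    intro x
    by_cases hx : p₀.1 ≤ x ∧ x ≤ p₁.1
    · have hne : (P.cells.filter fun c => c.1 = x).Nonempty := by
        rcases hx.2.lt_or_eq with h | rfl
        · obtain ⟨y, hy, -⟩ := overlap x hx.1 h
          exact ⟨(x, y), Finset.mem_filter.2 ⟨hy, rfl⟩⟩
        · exact ⟨p₁, Finset.mem_filter.2 ⟨hp₁, rfl⟩⟩
      obtain ⟨⟨u, a⟩, hu, ha⟩ := Finset.exists_min_image _ Prod.snd hne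
      obtain ⟨⟨v, b⟩, hv, hb⟩ := Finset.exists_max_image _ Prod.snd hne
      obtain ⟨hu', hux⟩ := Finset.mem_filter.1 hu
      obtain ⟨hv', hvx⟩ := Finset.mem_filter.1 hv
      dsimp only at hux hvx ha hb
      subst hux hvx
      refine ⟨a, b + 1, fun _ _ => ⟨?_, fun y => ⟨fun h => ?_, fun h => ?_⟩⟩⟩
      · have := ha _ hv
        dsimp only at this
        omega
      · have := ha _ (Finset.mem_filter.2 ⟨h, rfl⟩)
        have := hb _ (Finset.mem_filter.2 ⟨h, rfl⟩)
        dsimp only at *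
        omega
      · exact convex hu' hv' h.1 (by omega)
    · exact ⟨0, 0, fun h1 h2 => absurd ⟨h1, h2⟩ hx⟩
  choose m t hmt using col
  have step : ∀ x, p₀.1 ≤ x → x < p₁.1 →
      m x ≤ m (x + 1) ∧ t x ≤ t (x + 1) ∧ m (x + 1) < t x := by
    intro x h1 h2
    obtain ⟨k1, k2⟩ := hmt x h1 h2.le
    obtain ⟨l1, l2⟩ := hmt (x + 1) (by omega) (by omega)
    refine ⟨?_, ?_, ?_⟩
    -- If the lower end dropped, the two lowest cells would span a rectangle and put a cell below
    -- the lower end of column `x`.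
    · by_contra! h
      have := (k2 _).1 (antidiag (by omega) h ((k2 (m x)).2 (by omega))
        ((l2 (m (x + 1))).2 (by omega))).2
      omega
    · by_contra! h
      have := (l2 _).1 (antidiag (y := t x - 1) (y' := t (x + 1) - 1) (by omega) (by omega)
        ((k2 _).2 (by omega)) ((l2 _).2 (by omega))).1
      omega
    · obtain ⟨y, hy, hy'⟩ := overlap x h1 h2
      have := (k2 _).1 hy
      have := (l2 _).1 hy'
      omega
  have hn : p₀.1 + ((p₁.1 - p₀.1).toNat : ℤ) = p₁.1 := by omega
  -- The values outside the range give empty columns there and preserve monotonicity. They also make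
  -- the upper staircase begin, and the lower one finish, with the whole extreme vertical side.
  refine ⟨p₀.1, (p₁.1 - p₀.1).toNat,
    fun x => if x < p₀.1 then m p₀.1 else if x ≤ p₁.1 then m x else t p₁.1,
    fun x => if x < p₀.1 then m p₀.1 else if x ≤ p₁.1 then t x else t p₁.1, ?_⟩
  rw [hn]
  refine ⟨monotone_int_of_le_succ fun x => ?_, monotone_int_of_le_succ fun x => ?_, ?_, ?_, ?_, ?_,
    fun x h1 h2 => ?_, fun x h1 h2 => ?_, fun x y => ⟨fun h => ?_, ?_⟩⟩
  · have h1 := step x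
    have h2 := hmt x
    split_ifs <;> first | omega | skip
    · rw [show x + 1 = p₀.1 by omega]
    · obtain rfl : x = p₁.1 := by omega
      exact (h2 h01 le_rfl).1.le
  · have h1 := step x
    have h2 := hmt x
    split_ifs <;> first | omega | skip
    · rw [show x + 1 = p₀.1 by omega]
      exact (hmt _ le_rfl h01).1.le
    · obtain rfl : x = p₁.1 := by omega
      exact le_rfl
  · simp [h01]
  · simp [h01]
  · dsimp only
    split_ifs <;> omega
  · dsimp only
    split_ifs <;> omega
  · dsimp only
    rw [if_neg (by omega), if_pos h2, if_neg (by omega), if_pos h2]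
    exact (hmt x h1 h2).1
  · dsimp only
    rw [if_neg (by omega), if_pos (by omega), if_neg (by omega), if_pos (by omega)]
    exact (step x h1 h2).2.2
  · have h1 : p₀.1 ≤ x := hmin _ h
    have h2 : x ≤ p₁.1 := hmax _ h
    dsimp only
    rw [if_neg (by omega), if_pos h2, if_neg (by omega), if_pos h2]
    exact ⟨h1, h2, ((hmt x h1 h2).2 y).1 h⟩
  · rintro ⟨h1, h2, h3⟩
    dsimp only at h3
    rw [if_neg (by omega), if_pos h2, if_neg (by omega), if_pos h2] at h3
    exact ((hmt x h1 h2).2 y).2 h3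

/-! ### Staircase paths -/

/-- The steps of the path from `(x, f (x - 1))` to `(x + n, f (x + n))` whose `n` east steps are
at heights `f x, …, f (x + n - 1)`. -/
def stairSteps (f : ℤ → ℤ) : ℤ → ℕ → List LatticeStep
  | x, 0 => List.replicate (f x - f (x - 1)).toNat .north
  | x, n + 1 => List.replicate (f x - f (x - 1)).toNat .north ++ .east :: stairSteps f (x + 1) n

theorem pathEnd_replicate_north (k : ℕ) (x y : ℤ) (w : List LatticeStep) :
    pathEnd (x, y) (List.replicate k .north ++ w) = pathEnd (x, y + k) w := by
  induction k generalizing y with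
  | zero => simp
  | succ k ih =>
    rw [List.replicate_succ, List.cons_append, pathEnd, LatticeStep.move, ih]
    push_cast
    congr 2
    ring

theorem mem_pathEdges_replicate_north (k : ℕ) (x y : ℤ) (w : List LatticeStep)
    (x' y' : ℤ) (s : LatticeStep) :
    ((x', y'), s) ∈ pathEdges (x, y) (List.replicate k .north ++ w) ↔
      (s = .north ∧ x' = x ∧ y ≤ y' ∧ y' < y + k) ∨
        ((x', y'), s) ∈ pathEdges (x, y + k) w := by
  induction k generalizing y with
  | zero =>
    simp only [List.replicate_zero, List.nil_append, Nat.cast_zero, add_zero]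
    constructor
    · exact Or.inr
    · rintro (h | h)
      · omega
      · exact h
  | succ k ih =>
    rw [List.replicate_succ, List.cons_append, pathEdges, LatticeStep.move, Set.mem_insert_iff, ih]
    have e : y + 1 + (k : ℤ) = y + ((k + 1 : ℕ) : ℤ) := by push_cast; ring
    rw [e, ← or_assoc]
    refine or_congr_left ?_
    simp only [Prod.mk.injEq]
    constructor
    · rintro (⟨⟨rfl, rfl⟩, rfl⟩ | ⟨rfl, rfl, h⟩)
      · exact ⟨rfl, rfl, by omega, by omega⟩
      · exact ⟨rfl, rfl, by omega, by omega⟩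
    · rintro ⟨rfl, rfl, h⟩
      by_cases hy : y' = y
      · exact Or.inl ⟨⟨rfl, hy⟩, rfl⟩
      · exact Or.inr ⟨rfl, rfl, by omega, by omega⟩

theorem mem_pathPoints_replicate_north (k : ℕ) (x y : ℤ) (w : List LatticeStep) (x' y' : ℤ) :
    (x', y') ∈ pathPoints (x, y) (List.replicate k .north ++ w) ↔
      (x' = x ∧ y ≤ y' ∧ y' < y + k) ∨ (x', y') ∈ pathPoints (x, y + k) w := by
  induction k generalizing y with
  | zero =>
    simp only [List.replicate_zero, List.nil_append, Nat.cast_zero, add_zero]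
    constructor
    · exact Or.inr
    · rintro (h | h)
      · omega
      · exact h
  | succ k ih =>
    rw [List.replicate_succ, List.cons_append, pathPoints, LatticeStep.move, Set.mem_insert_iff, ih]
    have e : y + 1 + (k : ℤ) = y + ((k + 1 : ℕ) : ℤ) := by push_cast; ring
    rw [e, ← or_assoc]
    refine or_congr_left ?_
    simp only [Prod.mk.injEq]
    omega

theorem add_toNat_sub_of_monotone {f : ℤ → ℤ} (hf : Monotone f) (x : ℤ) :
    f (x - 1) + ((f x - f (x - 1)).toNat : ℤ) = f x := by
  have := hf (show x - 1 ≤ x by omega)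
  omega

theorem pathEnd_stairSteps {f : ℤ → ℤ} (hf : Monotone f) (x : ℤ) (n : ℕ) :
    pathEnd (x, f (x - 1)) (stairSteps f x n) = (x + n, f (x + n)) := by
  induction n generalizing x with
  | zero =>
    have := pathEnd_replicate_north (f x - f (x - 1)).toNat x (f (x - 1)) []
    rw [List.append_nil, add_toNat_sub_of_monotone hf] at this
    simpa [stairSteps, pathEnd] using this
  | succ n ih =>
    have := ih (x + 1)
    rw [add_sub_cancel_right] at this
    rw [stairSteps, pathEnd_replicate_north, add_toNat_sub_of_monotone hf, pathEnd,
      LatticeStep.move, this]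
    push_cast
    rw [show x + 1 + (n : ℤ) = x + (n + 1) by ring]

theorem mem_pathEdges_stairSteps_east {f : ℤ → ℤ} (hf : Monotone f) (x : ℤ) (n : ℕ) (x' y : ℤ) :
    ((x', y), LatticeStep.east) ∈ pathEdges (x, f (x - 1)) (stairSteps f x n) ↔
      x ≤ x' ∧ x' < x + n ∧ y = f x' := by
  induction n generalizing x with
  | zero =>
    have := mem_pathEdges_replicate_north (f x - f (x - 1)).toNat x (f (x - 1)) [] x' y .east
    rw [List.append_nil] at this
    rw [stairSteps, this]
    simp only [pathEdges, Set.mem_empty_iff_false, reduceCtorEq, false_and, or_false, false_iff]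
    push_cast
    omega
  | succ n ih =>
    have := ih (x + 1)
    rw [add_sub_cancel_right] at this
    rw [stairSteps, mem_pathEdges_replicate_north, add_toNat_sub_of_monotone hf, pathEdges,
      LatticeStep.move, Set.mem_insert_iff, this]
    simp only [reduceCtorEq, false_and, false_or, Prod.mk.injEq, and_true]
    push_cast
    constructor
    · rintro (⟨rfl, rfl⟩ | h)
      · exact ⟨by omega, by omega, rfl⟩
      · exact ⟨by omega, by omega, h.2.2⟩
    · rintro ⟨h1, h2, h3⟩
      by_cases hx : x' = x
      · exact Or.inl ⟨hx, hx ▸ h3⟩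
      · exact Or.inr ⟨by omega, by omega, h3⟩

theorem mem_pathEdges_stairSteps_north {f : ℤ → ℤ} (hf : Monotone f) (x : ℤ) (n : ℕ) (x' y : ℤ) :
    ((x', y), LatticeStep.north) ∈ pathEdges (x, f (x - 1)) (stairSteps f x n) ↔
      x ≤ x' ∧ x' ≤ x + n ∧ f (x' - 1) ≤ y ∧ y < f x' := by
  induction n generalizing x with
  | zero =>
    have := mem_pathEdges_replicate_north (f x - f (x - 1)).toNat x (f (x - 1)) [] x' y .north
    rw [List.append_nil, add_toNat_sub_of_monotone hf] at this
    rw [stairSteps, this]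
    simp only [pathEdges, Set.mem_empty_iff_false, true_and, or_false]
    push_cast
    constructor
    · rintro ⟨rfl, h⟩
      exact ⟨le_rfl, by omega, h⟩
    · rintro ⟨h1, h2, h⟩
      obtain rfl : x' = x := by omega
      exact ⟨rfl, h⟩
  | succ n ih =>
    have := ih (x + 1)
    rw [add_sub_cancel_right] at this
    rw [stairSteps, mem_pathEdges_replicate_north, add_toNat_sub_of_monotone hf, pathEdges,
      LatticeStep.move, Set.mem_insert_iff, this]
    simp only [reduceCtorEq, and_false, false_or, true_and, Prod.mk.injEq]
    push_cast
    constructor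
    · rintro (⟨rfl, h⟩ | h)
      · exact ⟨le_rfl, by omega, h⟩
      · exact ⟨by omega, by omega, h.2.2⟩
    · rintro ⟨h1, h2, h3⟩
      by_cases hx : x' = x
      · exact Or.inl ⟨hx, hx ▸ h3⟩
      · exact Or.inr ⟨by omega, by omega, h3⟩

theorem mem_pathPoints_stairSteps {f : ℤ → ℤ} (hf : Monotone f) (x : ℤ) (n : ℕ) (x' y : ℤ) :
    (x', y) ∈ pathPoints (x, f (x - 1)) (stairSteps f x n) ↔
      x ≤ x' ∧ x' ≤ x + n ∧ f (x' - 1) ≤ y ∧ y ≤ f x' := by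
  induction n generalizing x with
  | zero =>
    have hle := hf (show x - 1 ≤ x by omega)
    have := mem_pathPoints_replicate_north (f x - f (x - 1)).toNat x (f (x - 1)) [] x' y
    rw [List.append_nil, add_toNat_sub_of_monotone hf] at this
    rw [stairSteps, this]
    simp only [pathPoints, Set.mem_singleton_iff, Prod.mk.injEq]
    push_cast
    constructor
    · rintro (⟨rfl, h⟩ | ⟨rfl, rfl⟩)
      · exact ⟨le_rfl, by omega, by omega⟩
      · exact ⟨le_rfl, by omega, by omega⟩
    · rintro ⟨h1, h2, h⟩
      obtain rfl : x' = x := by omega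
      omega
  | succ n ih =>
    have hle := hf (show x - 1 ≤ x by omega)
    have := ih (x + 1)
    rw [add_sub_cancel_right] at this
    rw [stairSteps, mem_pathPoints_replicate_north, add_toNat_sub_of_monotone hf, pathPoints,
      LatticeStep.move, Set.mem_insert_iff, this]
    simp only [Prod.mk.injEq]
    push_cast
    constructor
    · rintro (⟨rfl, h⟩ | ⟨rfl, rfl⟩ | h)
      · exact ⟨le_rfl, by omega, by omega⟩
      · exact ⟨le_rfl, by omega, by omega⟩
      · exact ⟨by omega, by omega, h.2.2⟩
    · rintro ⟨h1, h2, h3⟩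
      by_cases hx : x' = x
      · subst hx
        omega
      · exact Or.inr (Or.inr ⟨by omega, by omega, h3⟩)

/-! ### The boundary as two staircases -/

theorem Polyomino.isParallelogram_of_fillsCorners {P : Polyomino}
    (hP : FillsCorners (P.cells : Set (ℤ × ℤ))) : P.IsParallelogram := by
  obtain ⟨x₀, n, f, g, hf, hg, hf0, hg0, hf1, hg1, hlt, hov, hmem⟩ := P.exists_profile hP
  have hp : ((x₀, f (x₀ - 1)) : ℤ × ℤ) = (x₀, g (x₀ - 1)) := by rw [hf0, hg0]
  have he : x₀ + ((n + 1 : ℕ) : ℤ) = x₀ + n + 1 := by push_cast; ring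
  have hov' : ∀ x, x₀ < x → x ≤ x₀ + n → f x < g (x - 1) := by
    intro x h1 h2
    have := hov (x - 1) (by omega) (by omega)
    rwa [sub_add_cancel] at this
  have hfs : ∀ x, f (x - 1) ≤ f x := fun x => hf (by omega)
  have hgs : ∀ x, g (x - 1) ≤ g x := fun x => hg (by omega)
  -- There are `n + 1` columns, hence `n + 1` east steps.
  refine ⟨(x₀, g (x₀ - 1)), (x₀ + n + 1, g (x₀ + n + 1)), stairSteps g x₀ (n + 1),
    stairSteps f x₀ (n + 1), ?_, ?_, ?_, ?_, ?_⟩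
  · rw [pathEnd_stairSteps hg, he]
  · rw [← hp, pathEnd_stairSteps hf, he, hf1]
  · ext ⟨x, y⟩
    rw [Set.mem_inter_iff, mem_pathPoints_stairSteps hg, ← hp, mem_pathPoints_stairSteps hf, he]
    simp only [Set.mem_insert_iff, Set.mem_singleton_iff, Prod.mk.injEq]
    have e1 : x₀ + (n : ℤ) + 1 - 1 = x₀ + n := by ring
    have e2 := hlt x₀ le_rfl (by omega)
    have e3 := hlt (x₀ + n) (by omega) le_rfl
    constructor
    · rintro ⟨⟨h1, h2, h3, h4⟩, -, -, h5, h6⟩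
      by_cases hx : x = x₀
      · subst hx
        omega
      · by_cases hx' : x = x₀ + n + 1
        · subst hx'
          rw [e1] at h3
          omega
        -- On an inner vertical line, the lower path stays at or below `f x` and the upper one at or
        -- above `g (x - 1)`, which is larger.
        · have := hov' x (by omega) (by omega)
          omega
    · rintro (⟨rfl, rfl⟩ | ⟨rfl, rfl⟩)
      · omega
      · rw [e1]
        omega
  · rw [Set.disjoint_left]
    rintro ⟨⟨x, y⟩, s | s⟩ h h'
    · rw [mem_pathEdges_stairSteps_north hg, he] at h
      rw [← hp, mem_pathEdges_stairSteps_north hf, he] at h'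
      by_cases hx : x = x₀
      · subst hx
        omega
      · by_cases hx' : x = x₀ + n + 1
        · subst hx'
          rw [add_sub_cancel_right] at h h'
          omega
        · have := hov' x (by omega) (by omega)
          omega
    · rw [mem_pathEdges_stairSteps_east hg, he] at h
      rw [← hp, mem_pathEdges_stairSteps_east hf, he] at h'
      have := hlt x (by omega) (by omega)
      omega
  · ext ⟨⟨x, y⟩, s | s⟩
    · rw [Set.mem_union, mem_pathEdges_stairSteps_north hg, ← hp,
        mem_pathEdges_stairSteps_north hf, he]
      -- Since consecutive columns overlap and their ends are nondecreasing, their symmetric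
      -- difference is `[f (x - 1), f x)` together with `[g (x - 1), g x)`. At the two extreme lines
      -- one column is empty.
      change Xor ((x - 1, y) ∈ P.cells) ((x, y) ∈ P.cells) ↔ _
      rw [hmem, hmem]
      simp only [Xor]
      have := hfs x
      have := hgs x
      by_cases hx : x = x₀
      · subst hx
        omega
      · by_cases hx' : x = x₀ + n + 1
        · subst hx'
          rw [add_sub_cancel_right] at *
          omega
        · by_cases hr : x₀ < x ∧ x ≤ x₀ + n
          · have := hov' x hr.1 hr.2
            omega
          · omega
    · rw [Set.mem_union, mem_pathEdges_stairSteps_east hg, ← hp,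
        mem_pathEdges_stairSteps_east hf, he]
      change Xor ((x, y) ∈ P.cells) ((x, y - 1) ∈ P.cells) ↔ _
      rw [hmem, hmem]
      simp only [Xor]
      have := hlt x
      omega

theorem mainTheorem8 :
    {P : Polyomino | P.IsParallelogram} =
      Polyomino.Av {⟨2, 2, !![1, 0; 1, 1]⟩, ⟨2, 2, !![1, 1; 0, 1]⟩} := by
  ext P
  rw [Polyomino.mem_Av_iff_fillsCorners]
  exact ⟨Polyomino.IsParallelogram.fillsCorners, Polyomino.isParallelogram_of_fillsCorners⟩
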